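/- Let $d\ge 1$, $p,q\in(0,\infty]$, and let $\emptyset\neq\mathcal O\subset\mathbb R^d$ be open. The Fourier transform is $\widehat f(\xi)=\mathcal Ff(\xi)=\int f(x)e^{-2\pi i\langle x,\xi\rangle}\,dx$. Let $\mathcal Q=(Q_i)_{i\in I}=(T_iQ_i'+b_i)_{i\in I}$, with $T_i\in\mathrm{GL}(\mathbb R^d)$, $Q_i'\subset\mathbb R^d$, $b_i\in\mathbb R^d$, and write $i^*=\{j\in I: Q_i\cap Q_j\neq\emptyset\}$. Assume that $\mathcal Q$ is an *$L^p$-decomposition covering* of $\mathcal O$, i.e. * (semi-structured admissible covering) $\bigcup_i Q_i=\mathcal O$, all $Q_i\neq\emptyset$, $\sup_i|i^*|<\infty$, $\bigcup_iQ_i'$ is bounded and $\sup_{i}\sup_{j\in i^*}\|T_i^{-1}T_j\|<\infty$; * there is an *$L^p$-BAPU* $\Phi=(\varphi_i)_{i\in I}$ for $\mathcal Q$: $\varphi_i\in C_c^\infty(\mathcal O)$, $\varphi_i=0$ off $Q_i$, $\sum_i\varphi_i=1$ on $\mathcal O$, and $\sup_i\|\mathcal F^{-1}\varphi_i\|_{L^1}<\infty$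 if $p\ge1$, respectively $\sup_i|\det T_i|^{1/p-1}\|\mathcal F^{-1}\varphi_i\|_{L^p}<\infty$ if $p<1$. Let $\{0\}\neq Y\le\mathbb C^I$ be a *$\mathcal Q$-regular sequence space*: a subspace of $\mathbb C^I$ with a complete quasi-norm $\|\cdot\|_Y$ that is solid (if $x\in\mathbb C^I$, $y\in Y$ and $|x_i|\le|y_i|$ for all $i$, then $x\in Y$ and $\|x\|_Y\le\|y\|_Y$) and for which the clustering map $x\mapsto(\sum_{\ell\in i^*}x_\ell)_{i\in I}$ is a well-defined bounded map $Y\to Y$. Let $Z(\mathcal O)=\mathcal F(C_c^\infty(\mathcal O))$ carry the topology making $\mathcal F:C_c^\infty(\mathcal O)\to Z(\mathcal O)$ a homeomorphism, and for $f$ in its dual $Z'(\mathcal O)$ put $\widehat f=f\circ\mathcal F\in\mathcal D'(\mathcal O)$. The decomposition space $\mathcal D(\mathcal Q,L^p,Y)$ is the set of all $f\in Z'(\mathcal O)$ with $$\|f\|_{\mathcal D(\mathcal Q,L^p,Y)}=\Big\|\big(\|\mathcal F^{-1}(\varphi_i\widehat f)\|_{L^p}\big)_{i\in I}\Big\|_Y<\infty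 ,$$ where $\mathcal F^{-1}(\varphi_i\widehat f)(x)=\langle\widehat f,\varphi_ie^{2\pi i\langle x,\cdot\rangle}\rangle$, the quasi-norm being $\infty$ if an entry is infinite or the sequence is not in $Y$, and where $\Phi=(\varphi_i)$ is any fixed $L^p$-BAPU for $\mathcal Q$ (the result holds for each choice). Finally let $$\mathcal S_{\mathcal O}^{p,Y}(\mathbb R^d)=\{f\in\mathcal S(\mathbb R^d):\widehat f\in C_c^\infty(\mathcal O)\}\cap\mathcal D(\mathcal Q,L^p,Y),$$ where $f\in\mathcal S(\mathbb R^d)$ is identified with the functional $g\mapsto\int fg$ in $Z'(\mathcal O)$. **Theorem.** If for some multiindex $\alpha\in\mathbb N_0^d$ the map $$\partial^\alpha:\ \mathcal S_{\mathcal O}^{p,Y}(\mathbb R^d)\to L^q(\mathbb R^d)$$ is bounded with respect to $\|\cdot\|_{\mathcal D(\mathcal Q,L^p,Y)}$, i.e. $\|\partial^\alpha f\|_{L^q}\le C\|f\|_{\mathcal D(\mathcal Q,L^p,Y)}$ for some $C<\infty$ and all $f\in\mathcal S_{\mathcal O}^{p,Y}(\mathbb R^d)$, then $p\le q$. -/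

import Mathlib

open MeasureTheory TopologicalSpace Filter
open scoped ENNReal NNReal Topology Distributions SchwartzMap FourierTransform LineDeriv

noncomputable section

namespace DecompositionSpace

/-- Euclidean space `ℝ^d`. -/
abbrev Euc (d : ℕ) : Type := EuclideanSpace ℝ (Fin d)

/-! ### Coverings -/

/-- The data `(Q_i)_{i ∈ I} = (T_i Q_i' + b_i)_{i ∈ I}` of a family of subsets of `ℝ^d` with
invertible linear maps `T_i`, base sets `Q_i'` and shifts `b_i`. -/
structure AffineFamily (d : ℕ) (I : Type*) where
  /-- the invertible linear parts -/
  T : I → (Euc d ≃L[ℝ] Euc d)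
  /-- the base sets -/
  base : I → Set (Euc d)
  /-- the shifts -/
  b : I → Euc d

variable {d : ℕ} {I : Type*}

namespace AffineFamily

/-- The set `Q_i = T_i Q_i' + b_i`. -/
def cell (Q : AffineFamily d I) (i : I) : Set (Euc d) :=
  (fun ξ => Q.T i ξ + Q.b i) '' Q.base i

/-- The set `i^*` of neighbours of the index `i`. -/
def neighbors (Q : AffineFamily d I) (i : I) : Set I :=
  {j | (Q.cell i ∩ Q.cell j).Nonempty}

/-- `Q` is an admissible covering of `O`. -/
structure IsAdmissible (Q : AffineFamily d I) (O : Set (Euc d)) : Prop where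
  covers : (⋃ i, Q.cell i) = O
  nonempty : ∀ i, (Q.cell i).Nonempty
  card_neighbors_le : ∃ N : ℕ, ∀ i, (Q.neighbors i).encard ≤ N

/-- `Q` is a semi-structured (admissible) covering of `O`. -/
structure IsSemiStructured (Q : AffineFamily d I) (O : Set (Euc d)) : Prop
    extends Q.IsAdmissible O where
  isBounded_base : Bornology.IsBounded (⋃ i, Q.base i)
  norm_le : ∃ C : ℝ, ∀ i, ∀ j ∈ Q.neighbors i,
    ‖((Q.T i).symm : Euc d →L[ℝ] Euc d).comp (Q.T j : Euc d →L[ℝ] Euc d)‖ ≤ C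

/-- `|det T_i|`. -/
def absDet (Q : AffineFamily d I) (i : I) : ℝ :=
  |(Q.T i : Euc d →L[ℝ] Euc d).det|

end AffineFamily

/-! ### Partitions of unity -/

/-- `Φ = (φ_i)` is a partition of unity on `O` subordinate to `Q`. The condition
`φ_i ∈ C_c^∞(O)` is contained in the type of `Φ`. -/
structure IsPartitionOfUnity {O : Opens (Euc d)} (Q : AffineFamily d I) (Φ : I → 𝓓(O, ℂ)) :
    Prop where
  eq_zero : ∀ i, ∀ ξ ∉ Q.cell i, Φ i ξ = 0
  hasSum_one : ∀ ξ ∈ O, HasSum (fun i => Φ i ξ) 1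

/-- `Φ` is an `L^p`-BAPU (bounded admissible partition of unity) for the covering `Q`. -/
structure IsBAPU {O : Opens (Euc d)} (p : ℝ≥0∞) (Q : AffineFamily d I) (Φ : I → 𝓓(O, ℂ)) :
    Prop extends IsPartitionOfUnity Q Φ where
  bounded_of_one_le : 1 ≤ p → ∃ C : ℝ≥0, ∀ i,
    eLpNorm (𝓕⁻ (Φ i : Euc d → ℂ)) 1 volume ≤ C
  bounded_of_lt_one : p < 1 → ∃ C : ℝ≥0, ∀ i,
    ENNReal.ofReal (Q.absDet i ^ (1 / p.toReal - 1)) *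
      eLpNorm (𝓕⁻ (Φ i : Euc d → ℂ)) p volume ≤ C

/-! ### Sequence spaces -/

/-- A subspace `Y` of `ℂ^I` together with a real-valued function on it (its candidate
quasi-norm; the axioms are part of `IsRegular`). -/
structure SequenceSpace (I : Type*) where
  /-- the underlying subspace of `ℂ^I` -/
  carrier : Submodule ℂ (I → ℂ)
  /-- the quasi-norm -/
  qnorm : carrier → ℝ

namespace SequenceSpace

/-- The clustering map `x ↦ x^*` with `x^*_i = ∑_{ℓ ∈ i^*} x_ℓ`
(a finite sum for every admissible covering). -/
def clustering (Q : AffineFamily d I) (x : I → ℂ) : I → ℂ :=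
  fun i => ∑ᶠ (l : I) (_ : l ∈ Q.neighbors i), x l

/-- `Y` is a `Q`-regular sequence space: a solid quasi-Banach sequence space on which the
clustering map is well-defined and bounded. -/
structure IsRegular (Y : SequenceSpace I) (Q : AffineFamily d I) : Prop where
  nonneg : ∀ x, 0 ≤ Y.qnorm x
  eq_zero_iff : ∀ x, Y.qnorm x = 0 ↔ x = 0
  smul : ∀ (c : ℂ) (x : Y.carrier), Y.qnorm (c • x) = ‖c‖ * Y.qnorm x
  add_le : ∃ C : ℝ, 1 ≤ C ∧ ∀ x y, Y.qnorm (x + y) ≤ C * (Y.qnorm x + Y.qnorm y)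
  complete : ∀ u : ℕ → Y.carrier,
    (∀ ε > 0, ∃ N, ∀ m ≥ N, ∀ n ≥ N, Y.qnorm (u m - u n) < ε) →
      ∃ x, Tendsto (fun n => Y.qnorm (u n - x)) atTop (𝓝 0)
  solid : ∀ (x : I → ℂ) (y : Y.carrier), (∀ i, ‖x i‖ ≤ ‖(y : I → ℂ) i‖) →
    ∃ hx : x ∈ Y.carrier, Y.qnorm ⟨x, hx⟩ ≤ Y.qnorm y
  clustering_le : ∃ C : ℝ, ∀ x : Y.carrier,
    ∃ hx : clustering Q (x : I → ℂ) ∈ Y.carrier, Y.qnorm ⟨_, hx⟩ ≤ C * Y.qnorm x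

open scoped Classical in
/-- The extended quasi-norm of a sequence in `[0, ∞]`: it is `∞` if some entry is infinite or if
the sequence does not belong to `Y`. -/
def extNorm (Y : SequenceSpace I) (c : I → ℝ≥0∞) : ℝ≥0∞ :=
  if h : (∀ i, c i ≠ ∞) ∧ (fun i => ((c i).toReal : ℂ)) ∈ Y.carrier then
    ENNReal.ofReal (Y.qnorm ⟨_, h.2⟩)
  else ∞

end SequenceSpace

/-! ### Distributions on `O` and the reservoir `Z'(O)` -/

variable {O : Opens (Euc d)}

/-- A test function on `O` as a Schwartz function on `ℝ^d`. -/
def testToSchwartz (φ : 𝓓(O, ℂ)) : 𝓢(Euc d, ℂ) :=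
  φ.hasCompactSupport.toSchwartzMap φ.contDiff

@[simp] theorem testToSchwartz_apply (φ : 𝓓(O, ℂ)) (ξ : Euc d) : testToSchwartz φ ξ = φ ξ := rfl

/-- The Fourier transform `C_c^∞(O) → 𝓢(ℝ^d)`. -/
def testFourier (O : Opens (Euc d)) : 𝓓(O, ℂ) →ₗ[ℂ] 𝓢(Euc d, ℂ) where
  toFun φ := 𝓕 (testToSchwartz φ)
  map_add' φ ψ := by
    rw [show testToSchwartz (φ + ψ) = testToSchwartz φ + testToSchwartz ψ from rfl,
      FourierAdd.fourier_add]
  map_smul' c φ := by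
    rw [show testToSchwartz (c • φ) = c • testToSchwartz φ from rfl,
      FourierSMul.fourier_smul, RingHom.id_apply]

/-- The space `Z(O) = 𝓕(C_c^∞(O))`. -/
def ZSpace (O : Opens (Euc d)) : Submodule ℂ 𝓢(Euc d, ℂ) := LinearMap.range (testFourier O)

/-- The bijection `𝓕 : C_c^∞(O) → Z(O)`. -/
def fourierToZ (O : Opens (Euc d)) : 𝓓(O, ℂ) →ₗ[ℂ] ZSpace O := (testFourier O).rangeRestrict

/-- The dual `Z'(O)`. As `Z(O)` carries the topology that makes `𝓕 : C_c^∞(O) → Z(O)` a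
homeomorphism, a linear functional on `Z(O)` is continuous iff its composition with `𝓕` is. -/
structure ZDual (O : Opens (Euc d)) where
  /-- the linear functional -/
  toLin : ZSpace O →ₗ[ℂ] ℂ
  continuous_comp : Continuous fun φ : 𝓓(O, ℂ) => toLin (fourierToZ O φ)

/-- The Fourier transform `𝓕 : Z'(O) → 𝓓'(O)`, `f ↦ f ∘ 𝓕`. -/
def ZDual.fourier (f : ZDual O) : 𝓓(O, ℂ) →L[ℂ] ℂ where
  toLinearMap := f.toLin ∘ₗ fourierToZ O
  cont := f.continuous_comp

/-- A Schwartz function `f`, regarded as the element `g ↦ ∫ f g` of `Z'(O)`. -/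
def schwartzToZDual (O : Opens (Euc d)) (f : 𝓢(Euc d, ℂ)) : ZDual O where
  toLin :=
    { toFun := fun g => ∫ x, f x * (g : 𝓢(Euc d, ℂ)) x
      map_add' := fun g h => by
        have hi (g : 𝓢(Euc d, ℂ)) : Integrable fun x => f x * g x :=
          g.integrable.bdd_mul f.continuous.aestronglyMeasurable
            (.of_forall fun x => f.norm_le_seminorm ℝ x)
        simpa [mul_add] using integral_add (hi g) (hi h)
      map_smul' := fun c g => by
        simp only [Submodule.coe_smul, _root_.smul_apply, smul_eq_mul, RingHom.id_apply,
          mul_left_comm _ c]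
        exact integral_const_mul c _ }
  continuous_comp := by
    have hloc : LocallyIntegrableOn (𝓕 f : 𝓢(Euc d, ℂ)) O volume :=
      (𝓕 f : 𝓢(Euc d, ℂ)).integrable.locallyIntegrable.locallyIntegrableOn _
    have h := (TestFunction.integralAgainstBilinCLM (Ω := O) (n := ⊤)
      (ContinuousLinearMap.mul ℂ ℂ) volume (𝓕 f : 𝓢(Euc d, ℂ))).continuous
    refine h.congr fun φ => ?_
    rw [TestFunction.integralAgainstBilinCLM_eq_integral hloc]
    change ∫ x, φ x * (𝓕 f : 𝓢(Euc d, ℂ)) x = ∫ x, f x * (𝓕 (testToSchwartz φ) : 𝓢(Euc d, ℂ)) x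
    rw [← SchwartzMap.integral_fourier_mul_eq]
    exact integral_congr_ae (.of_forall fun x => mul_comm _ _)

/-- The test function `ξ ↦ φ(ξ) e^{2πi⟨x, ξ⟩}`. -/
def modulate (φ : 𝓓(O, ℂ)) (x : Euc d) : 𝓓(O, ℂ) where
  toFun ξ := φ ξ * Complex.exp ((2 * Real.pi * inner ℝ x ξ : ℝ) * Complex.I)
  contDiff' := φ.contDiff.mul (Complex.contDiff_exp.comp
    ((Complex.ofRealCLM.contDiff.comp (contDiff_const.mul (contDiff_const.inner ℝ contDiff_id))).mul
      contDiff_const))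
  hasCompactSupport' := φ.hasCompactSupport.mul_right
  tsupport_subset' := tsupport_mul_subset_left.trans φ.tsupport_subset

/-- The smooth function `𝓕⁻¹(φ u)` for `φ ∈ C_c^∞(O)` and a distribution `u` on `O`: by the
Paley–Wiener theorem it is `x ↦ ⟨u, φ e^{2πi⟨x, ·⟩}⟩`. -/
def localPiece (φ : 𝓓(O, ℂ)) (u : 𝓓(O, ℂ) →L[ℂ] ℂ) : Euc d → ℂ :=
  fun x => u (modulate φ x)

/-! ### Decomposition spaces -/

/-- The Fourier-side quasi-norm `‖(‖𝓕⁻¹(φ_i u)‖_{L^p})_i‖_Y ∈ [0, ∞]` of `u ∈ 𝓓'(O)`. -/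
def fourierSideNorm (p : ℝ≥0∞) (Y : SequenceSpace I) (Φ : I → 𝓓(O, ℂ))
    (u : 𝓓(O, ℂ) →L[ℂ] ℂ) : ℝ≥0∞ :=
  Y.extNorm fun i => eLpNorm (localPiece (Φ i) u) p volume

/-- The quasi-norm of `f ∈ Z'(O)` in the decomposition space `𝓓(Q, L^p, Y)`, computed with the
partition of unity `Φ`. -/
def decompNorm (p : ℝ≥0∞) (Y : SequenceSpace I) (Φ : I → 𝓓(O, ℂ)) (f : ZDual O) : ℝ≥0∞ :=
  fourierSideNorm p Y Φ f.fourier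

/-- The decomposition space `𝓓(Q, L^p, Y) ⊆ Z'(O)`. -/
def decompSpace (p : ℝ≥0∞) (Y : SequenceSpace I) (Φ : I → 𝓓(O, ℂ)) : Set (ZDual O) :=
  {f | decompNorm p Y Φ f < ∞}

/-- `𝓢_O(ℝ^d)`: the Schwartz functions whose Fourier transform lies in `C_c^∞(O)`. -/
def schwartzOn (O : Opens (Euc d)) : Set 𝓢(Euc d, ℂ) :=
  {f | HasCompactSupport (𝓕 f : 𝓢(Euc d, ℂ)) ∧ tsupport (𝓕 f : 𝓢(Euc d, ℂ)) ⊆ O}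

/-- `𝓢_O^{p,Y}(ℝ^d) = 𝓢_O(ℝ^d) ∩ 𝓓(Q, L^p, Y)`. -/
def schwartzDecomp (p : ℝ≥0∞) (Y : SequenceSpace I) (Φ : I → 𝓓(O, ℂ)) : Set 𝓢(Euc d, ℂ) :=
  {f | f ∈ schwartzOn O ∧ schwartzToZDual O f ∈ decompSpace p Y Φ}

/-- The partial derivative `∂^α f = ∂_1^{α_1} ⋯ ∂_d^{α_d} f` of a Schwartz function. -/
def multiDeriv (α : Fin d → ℕ) (f : 𝓢(Euc d, ℂ)) : 𝓢(Euc d, ℂ) :=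
  (List.finRange d).foldr
    (fun i g => (fun h : 𝓢(Euc d, ℂ) => ∂_{(EuclideanSpace.single i (1 : ℝ) : Euc d)} h)^[α i] g) f

/-- `∂^α : 𝓢_O^{p,Y}(ℝ^d) → L^q(ℝ^d)` is bounded. -/
def IsBoundedDeriv (p q : ℝ≥0∞) (Y : SequenceSpace I) (Φ : I → 𝓓(O, ℂ)) (α : Fin d → ℕ) : Prop :=
  ∃ C : ℝ≥0, ∀ f ∈ schwartzDecomp p Y Φ,
    eLpNorm (multiDeriv α f) q volume ≤ C * decompNorm p Y Φ (schwartzToZDual O f)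

end DecompositionSpace

end

open DecompositionSpace

noncomputable section

namespace DecompositionSpace

variable {d : ℕ} {I : Type*} {O : Opens (Euc d)}

/-! Translation costs nothing on the Fourier side, while sums of well-separated translates tell
Lebesgue exponents apart. Choose an index `j` whose unit vector lies in `Y` and with `Φ j ≠ 0`, and
let `g` be the inverse Fourier transform of `Φ j`. Put `g_N = ∑_{k<N} g(· - k R e)` for a unit
vector `e` and a large `R`. Translation acts on Fourier transforms as modulation, so `g_N` keeps the
Fourier support of `g`, and summing translates commutes both with `∂^α` and with the localizations
`𝓕⁻¹(φ_l 𝓕 ·)`.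

Upper bound: only the finitely many pieces with `l ∈ j^*` survive. Each is a sum of `N` translates
of a fixed Schwartz function, hence `O(N^{1/p})` (`exists_eLpNorm_translateSum_le`), and regularity
of `Y` turns this into `O(N^{1/p})` for the decomposition norm
(`exists_decompNorm_translateSum_le`). Lower bound: `∂^α g ≠ 0`, so for `q < ∞` and `R` large, `‖∂^α
g_N‖_q ≥ c N^{1/q}` (`exists_le_eLpNorm_translateSum`). Letting `N → ∞` gives `1/q ≤ 1/p`. -/

/-! ### Sums of translates of a Schwartz function -/

/-- The inverse quadratic weights along an arithmetic progression have bounded sums. -/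
theorem exists_sum_inv_one_add_sq_le :
    ∃ K : ℝ, 0 < K ∧ ∀ (s : ℝ) (N : ℕ),
      ∑ k ∈ Finset.range N, (1 + (s - k) ^ 2)⁻¹ ≤ K := by
  have hsum : Summable fun j : ℤ => 4 * (1 + (j : ℝ) ^ 2)⁻¹ := by
    have h2 : Summable fun j : ℤ => 1 / (j : ℝ) ^ 2 :=
      Real.summable_one_div_int_pow.2 (by norm_num)
    refine Summable.mul_left _ (h2.of_norm_bounded_eventually ?_)
    -- The comparison fails only at `j = 0`, where `1 / j ^ 2` is `0` by convention.
    refine (Set.finite_singleton (0 : ℤ)).subset fun j hj => ?_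
    by_contra h0
    have h0' : (j : ℝ) ≠ 0 := by exact_mod_cast h0
    refine hj ?_
    have : 0 < (j : ℝ) ^ 2 := by positivity
    change ‖(1 + (j : ℝ) ^ 2)⁻¹‖ ≤ 1 / (j : ℝ) ^ 2
    rw [Real.norm_of_nonneg (by positivity), one_div]
    gcongr
    linarith
  have hnn : ∀ j : ℤ, 0 ≤ 4 * (1 + (j : ℝ) ^ 2)⁻¹ := fun j => by positivity
  refine ⟨(∑' j : ℤ, 4 * (1 + (j : ℝ) ^ 2)⁻¹) + 1, by
    exact add_pos_of_nonneg_of_pos (tsum_nonneg hnn) one_pos, fun s N => ?_⟩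
  have hinj : Function.Injective fun k : ℕ => (k : ℤ) - round s := fun a b h => by
    simpa using h
  calc ∑ k ∈ Finset.range N, (1 + (s - k) ^ 2)⁻¹
      ≤ ∑ k ∈ Finset.range N, 4 * (1 + (((k : ℤ) - round s : ℤ) : ℝ) ^ 2)⁻¹ := by
        -- Rounding moves `s` by at most `1/2`, which changes the weight by a factor of at most `4`
        -- and makes the bound uniform in `s`.
        refine Finset.sum_le_sum fun k _ => ?_
        have hr := abs_le.1 (abs_sub_round s)
        rw [← div_eq_mul_inv, inv_eq_one_div, div_le_div_iff₀ (by positivity) (by positivity)]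
        push_cast
        nlinarith [sq_nonneg ((k : ℝ) - round s - 2 * (s - round s)),
          sq_nonneg ((k : ℝ) - round s), mul_nonneg (sub_nonneg.2 hr.1) (sub_nonneg.2 hr.2),
          sq_nonneg (3 * ((k : ℝ) - round s) - 4 * (s - round s))]
    _ = ∑ j ∈ (Finset.range N).map ⟨_, hinj⟩, 4 * (1 + (j : ℝ) ^ 2)⁻¹ := by
        rw [Finset.sum_map]; rfl
    _ ≤ ∑' j : ℤ, 4 * (1 + (j : ℝ) ^ 2)⁻¹ := hsum.sum_le_tsum _ fun j _ => hnn j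
    _ ≤ _ := by linarith

/-- The operator `f ↦ ∑_{k < N} f(· - k v)`. -/
def translateSum (N : ℕ) (v : Euc d) : 𝓢(Euc d, ℂ) →L[ℂ] 𝓢(Euc d, ℂ) :=
  ∑ k ∈ Finset.range N, SchwartzMap.compSubConstCLM ℂ ((k : ℝ) • v)

theorem translateSum_apply (N : ℕ) (v : Euc d) (f : 𝓢(Euc d, ℂ)) (x : Euc d) :
    translateSum N v f x = ∑ k ∈ Finset.range N, f (x - (k : ℝ) • v) := by
  simp [translateSum]

/-- `(1 + |y|²) f(y)` as a Schwartz function. -/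
def quadWeight (f : 𝓢(Euc d, ℂ)) : 𝓢(Euc d, ℂ) :=
  SchwartzMap.smulLeftCLM (𝕜 := ℝ) ℂ (fun y : Euc d => 1 + ‖y‖ ^ 2) f

theorem norm_quadWeight (f : 𝓢(Euc d, ℂ)) (y : Euc d) :
    ‖quadWeight f y‖ = (1 + ‖y‖ ^ 2) * ‖f y‖ := by
  rw [quadWeight, SchwartzMap.smulLeftCLM_apply_apply (by fun_prop), norm_smul,
    Real.norm_of_nonneg (by positivity)]

/-- Cauchy–Schwarz against `e` reduces decay in `ℝ^d` to decay along a line, so the one-dimensional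
weight sums apply. -/
theorem inner_sq_le_norm_sub_smul_sq {e : Euc d} (he : ‖e‖ = 1) {R : ℝ} (hR : 1 ≤ R)
    (x : Euc d) (k : ℝ) : (inner ℝ x e / R - k) ^ 2 ≤ ‖x - k • R • e‖ ^ 2 := by
  have h1 : inner ℝ (x - k • R • e) e = R * (inner ℝ x e / R - k) := by
    rw [inner_sub_left, inner_smul_left, inner_smul_left, real_inner_self_eq_norm_sq, he]
    simp
    field_simp
  have h2 : |R * (inner ℝ x e / R - k)| ≤ ‖x - k • R • e‖ := by
    rw [← h1]
    simpa [he] using abs_real_inner_le_norm (x - k • R • e) e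
  rw [abs_mul, abs_of_pos (by linarith)] at h2
  rw [← sq_abs]
  gcongr
  exact (le_mul_of_one_le_left (abs_nonneg _) hR).trans h2

/-- `‖∑_{k < N} f(· - k v)‖_p ≤ C N^{1/p}` if `|v| ≥ 1`. -/
theorem exists_eLpNorm_translateSum_le {p : ℝ≥0∞} (hp : p ≠ 0) {e : Euc d} (he : ‖e‖ = 1) {R : ℝ}
    (hR : 1 ≤ R) (f : 𝓢(Euc d, ℂ)) :
    ∃ C : ℝ≥0, ∀ N : ℕ,
      eLpNorm (translateSum N (R • e) f) p volume ≤ C * (N : ℝ≥0∞) ^ (1 / p.toReal) := by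
  obtain ⟨K, hK, hKs⟩ := exists_sum_inv_one_add_sq_le
  -- Quadratic decay makes the sum over `k` cost only the constant `K`: the sum is controlled by the
  -- largest weighted translate.
  have key (N : ℕ) (x : Euc d) (M : ℝ) (hM0 : 0 ≤ M)
      (hM : ∀ k ∈ Finset.range N, ‖quadWeight f (x - (k : ℝ) • R • e)‖ ≤ M) :
      ‖translateSum N (R • e) f x‖ ≤ K * M := by
    rw [translateSum_apply]
    refine (norm_sum_le _ _).trans ?_
    calc ∑ k ∈ Finset.range N, ‖f (x - (k : ℝ) • R • e)‖
        ≤ ∑ k ∈ Finset.range N, (1 + (inner ℝ x e / R - k) ^ 2)⁻¹ * M := by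
          refine Finset.sum_le_sum fun k hk => ?_
          have h := hM k hk
          rw [norm_quadWeight] at h
          rw [inv_mul_eq_div, le_div_iff₀ (by positivity), mul_comm]
          refine le_trans ?_ h
          exact mul_le_mul_of_nonneg_right
            (add_le_add_right (inner_sq_le_norm_sub_smul_sq he hR x k) 1) (norm_nonneg _)
      _ ≤ K * M := by
          rw [← Finset.sum_mul]
          gcongr
          exact hKs _ _
  rcases eq_or_ne p ∞ with rfl | hpt
  · refine ⟨(K * SchwartzMap.seminorm ℝ 0 0 (quadWeight f)).toNNReal, fun N => ?_⟩
    -- Here `1 / p.toReal = 1 / 0 = 0`, so the claim is a bound independent of `N`.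
    simp only [ENNReal.toReal_top, div_zero, ENNReal.rpow_zero, mul_one, eLpNorm_exponent_top]
    refine eLpNormEssSup_le_of_ae_bound (.of_forall fun x => key N x _ (by positivity) ?_)
    exact fun k _ => SchwartzMap.norm_le_seminorm ℝ _ _
  · have hp0 : 0 < p.toReal := ENNReal.toReal_pos hp hpt
    have hB : eLpNorm (quadWeight f) p volume ≠ ∞ := ((quadWeight f).eLpNorm_lt_top p volume).ne
    refine ⟨(ENNReal.ofReal K * eLpNorm (quadWeight f) p volume).toNNReal, fun N => ?_⟩
    rw [ENNReal.coe_toNNReal (ENNReal.mul_ne_top ENNReal.ofReal_ne_top hB)]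
    have hpt' (x : Euc d) : ‖translateSum N (R • e) f x‖ₑ ^ p.toReal ≤
        ENNReal.ofReal K ^ p.toReal *
          ∑ k ∈ Finset.range N, ‖quadWeight f (x - (k : ℝ) • R • e)‖ₑ ^ p.toReal := by
      set S : ℝ := ∑ k ∈ Finset.range N, ‖quadWeight f (x - (k : ℝ) • R • e)‖ ^ p.toReal with hS
      have hS0 : 0 ≤ S := by positivity
      -- The `ℓ^p` norm of the weighted translates dominates their maximum. Integrating `p`-th
      -- powers then gives exactly `N` equal terms, with no triangle inequality, so `p < 1` is
      -- covered too.
      have h := key N x (S ^ p.toReal⁻¹) (by positivity) fun k hk =>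
        (Real.le_rpow_inv_iff_of_pos (norm_nonneg _) hS0 hp0).2 <|
          Finset.single_le_sum (f := fun k : ℕ =>
            ‖quadWeight f (x - (k : ℝ) • R • e)‖ ^ p.toReal) (fun k _ => by positivity) hk
      have h' : ‖translateSum N (R • e) f x‖ ^ p.toReal ≤ K ^ p.toReal * S := by
        have h2 := Real.rpow_le_rpow (norm_nonneg _) h hp0.le
        rwa [Real.mul_rpow hK.le (by positivity), Real.rpow_inv_rpow hS0 hp0.ne'] at h2
      have h3 := ENNReal.ofReal_le_ofReal h'
      rw [ENNReal.ofReal_mul (by positivity), hS,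
        ENNReal.ofReal_sum_of_nonneg fun k _ => by positivity] at h3
      simpa only [← ENNReal.ofReal_rpow_of_nonneg (norm_nonneg _) hp0.le,
        ← ENNReal.ofReal_rpow_of_nonneg hK.le hp0.le, ofReal_norm] using h3
    have hint : ∫⁻ x, ‖translateSum N (R • e) f x‖ₑ ^ p.toReal ≤
        ENNReal.ofReal K ^ p.toReal * (N * ∫⁻ x, ‖quadWeight f x‖ₑ ^ p.toReal) := by
      refine (lintegral_mono hpt').trans ?_
      have hmeas (v : Euc d) : Measurable fun x => ‖quadWeight f (x - v)‖ₑ ^ p.toReal :=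
        (((quadWeight f).continuous.comp (continuous_id.sub continuous_const)).measurable.enorm
          ).pow_const _
      rw [lintegral_const_mul _ (Finset.measurable_sum _ fun k _ => hmeas _),
        lintegral_finsetSum _ fun k _ => hmeas _]
      simp only [lintegral_sub_right_eq_self (fun x => ‖quadWeight f x‖ₑ ^ p.toReal),
        Finset.sum_const, Finset.card_range, nsmul_eq_mul, le_refl]
    rw [eLpNorm_eq_lintegral_rpow_enorm_toReal hp hpt,
      eLpNorm_eq_lintegral_rpow_enorm_toReal hp hpt]
    refine (ENNReal.rpow_le_rpow hint (by positivity)).trans_eq ?_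
    rw [ENNReal.mul_rpow_of_nonneg _ _ (by positivity),
      ENNReal.mul_rpow_of_nonneg _ _ (by positivity), ← ENNReal.rpow_mul, mul_one_div_cancel hp0.ne',
      ENNReal.rpow_one]
    ring

/-- For a nonzero `f`, `‖∑_{k < N} f(· - k v)‖_q ≥ c N^{1/q}` if `|v|` is large. -/
theorem exists_le_eLpNorm_translateSum {q : ℝ≥0∞} (hq : q ≠ 0) (hqt : q ≠ ∞) {e : Euc d}
    (he : ‖e‖ = 1) {f : 𝓢(Euc d, ℂ)} (hf : f ≠ 0) :
    ∃ R : ℝ, 1 ≤ R ∧ ∃ c : ℝ≥0∞, c ≠ 0 ∧ ∀ N : ℕ,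
      c * (N : ℝ≥0∞) ^ (1 / q.toReal) ≤ eLpNorm (translateSum N (R • e) f) q volume := by
  obtain ⟨K, hK, hKs⟩ := exists_sum_inv_one_add_sq_le
  obtain ⟨x₀, hx₀⟩ : ∃ x, f x ≠ 0 := by
    by_contra! h
    exact hf (SchwartzMap.ext h)
  set a := ‖f x₀‖ with ha
  have ha0 : 0 < a := norm_pos_iff.2 hx₀
  obtain ⟨r, hr, hfr⟩ : ∃ r > 0, ∀ x ∈ Metric.ball x₀ r, a / 2 < ‖f x‖ :=
    Metric.eventually_nhds_iff_ball.1 (f.continuous.norm.continuousAt.eventually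
      (lt_mem_nhds (half_lt_self ha0)))
  set D := SchwartzMap.seminorm ℝ 0 0 (quadWeight f) with hD
  have hD0 : 0 ≤ D := by positivity
  have hfD (y : Euc d) : (1 + ‖y‖ ^ 2) * ‖f y‖ ≤ D := by
    rw [← norm_quadWeight]
    exact SchwartzMap.norm_le_seminorm ℝ _ _
  -- The term `2 (‖x₀‖ + r)` separates the balls around the translated peaks; `32 D K / a` makes the
  -- other translates contribute at most `a / 4` there.
  set R : ℝ := 1 + 2 * (‖x₀‖ + r) + 32 * D * K / a with hR
  have hDK : 0 ≤ 32 * D * K / a := by positivity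
  have hx₀n := norm_nonneg x₀
  have hR1 : 1 ≤ R := by linarith
  have hRr : 2 * (‖x₀‖ + r) ≤ R := by linarith
  have hRR : 8 * D / R ^ 2 * K ≤ a / 4 := by
    have h1 : 32 * D * K ≤ a * R := by
      have : a * (32 * D * K / a) = 32 * D * K := by field_simp
      nlinarith
    have h2 : a * R ≤ a * R ^ 2 := by
      gcongr
      nlinarith
    rw [div_mul_eq_mul_div, div_le_iff₀ (by positivity)]
    linarith
  have hpt (N : ℕ) (k : ℕ) (hk : k < N) (x : Euc d)
      (hx : x ∈ Metric.ball (x₀ + (k : ℝ) • R • e) r) :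
      a / 4 ≤ ‖translateSum N (R • e) f x‖ := by
    have hxr : ‖x - (k : ℝ) • R • e - x₀‖ < r := by
      rw [mem_ball_iff_norm] at hx
      rwa [sub_right_comm, sub_sub]
    have hmain := hfr (x - (k : ℝ) • R • e) (mem_ball_iff_norm.2 hxr)
    have hother (l : ℕ) (hl : l ≠ k) :
        ‖f (x - (l : ℝ) • R • e)‖ ≤ 8 * D / R ^ 2 * (1 + ((k : ℝ) - l) ^ 2)⁻¹ := by
      have hkl : 1 ≤ |(k : ℝ) - l| := by
        have : (1 : ℤ) ≤ |(k : ℤ) - l| := Int.one_le_abs (by omega)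
        exact_mod_cast this
      -- The distance is at least `R |k - l| - ‖x₀‖ - r`, and the loss is at most `R / 2 ≤ R |k - l|
      -- / 2`.
      have hy : R * |(k : ℝ) - l| / 2 ≤ ‖x - (l : ℝ) • R • e‖ := by
        have heq : x - (l : ℝ) • R • e =
            ((k : ℝ) - l) • R • e - (-(x - (k : ℝ) • R • e - x₀) - x₀) := by
          module
        have h1 := norm_sub_norm_le (((k : ℝ) - l) • R • e)
          (-(x - (k : ℝ) • R • e - x₀) - x₀)
        have h2 := norm_sub_le (-(x - (k : ℝ) • R • e - x₀)) x₀
        rw [norm_neg] at h2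
        rw [← heq, norm_smul, norm_smul, he, Real.norm_eq_abs, Real.norm_eq_abs,
          abs_of_pos (by linarith : 0 < R)] at h1
        nlinarith
      have hy2 : R ^ 2 * (1 + ((k : ℝ) - l) ^ 2) / 8 ≤ 1 + ‖x - (l : ℝ) • R • e‖ ^ 2 := by
        have h1 : (R * |(k : ℝ) - l| / 2) ^ 2 ≤ ‖x - (l : ℝ) • R • e‖ ^ 2 := by gcongr
        have h2 : 1 ≤ ((k : ℝ) - l) ^ 2 := by
          rw [← sq_abs]
          nlinarith
        have h3 : R ^ 2 * 1 ≤ R ^ 2 * ((k : ℝ) - l) ^ 2 := by gcongr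
        rw [div_pow, mul_pow, sq_abs] at h1
        nlinarith
      have h4 := (mul_le_mul_of_nonneg_right hy2 (norm_nonneg _)).trans (hfD _)
      rw [← div_eq_mul_inv, div_div, le_div_iff₀ (by positivity)]
      linarith
    rw [translateSum_apply, ← Finset.add_sum_erase _ _ (Finset.mem_range.2 hk)]
    have hsum : ‖∑ l ∈ (Finset.range N).erase k, f (x - (l : ℝ) • R • e)‖ ≤ a / 4 := by
      refine (norm_sum_le _ _).trans (le_trans ?_ hRR)
      calc ∑ l ∈ (Finset.range N).erase k, ‖f (x - (l : ℝ) • R • e)‖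
          ≤ ∑ l ∈ (Finset.range N).erase k, 8 * D / R ^ 2 * (1 + ((k : ℝ) - l) ^ 2)⁻¹ :=
            Finset.sum_le_sum fun l hl => hother l (Finset.ne_of_mem_erase hl)
        _ ≤ ∑ l ∈ Finset.range N, 8 * D / R ^ 2 * (1 + ((k : ℝ) - l) ^ 2)⁻¹ :=
            Finset.sum_le_sum_of_subset_of_nonneg (Finset.erase_subset _ _)
              fun l _ _ => by positivity
        _ ≤ 8 * D / R ^ 2 * K := by
            rw [← Finset.mul_sum]
            exact mul_le_mul_of_nonneg_left (hKs _ _) (by positivity)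
    -- The main translate exceeds `a / 2` and the rest sum to at most `a / 4`.
    have h5 := norm_sub_le_norm_add (f (x - (k : ℝ) • R • e))
      (∑ l ∈ (Finset.range N).erase k, f (x - (l : ℝ) • R • e))
    linarith
  have hvol (y : Euc d) : volume (Metric.ball y r) = volume (Metric.ball (0 : Euc d) r) :=
    Measure.addHaar_ball_center _ _ _
  refine ⟨R, hR1, ENNReal.ofReal (a / 4) * volume (Metric.ball (0 : Euc d) r) ^ (1 / q.toReal),
    ?_, fun N => ?_⟩
  · refine mul_ne_zero (by simpa using ha0) ?_
    simp only [ne_eq, ENNReal.rpow_eq_zero_iff, not_or, not_and_or]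
    exact ⟨.inl (Metric.measure_ball_pos _ _ hr).ne', .inl measure_ball_lt_top.ne⟩
  · set s : Set (Euc d) := ⋃ k ∈ Finset.range N, Metric.ball (x₀ + (k : ℝ) • R • e) r with hs
    have hsm : MeasurableSet s := Finset.measurableSet_biUnion _ fun _ _ => measurableSet_ball
    have hμs : volume s = N * volume (Metric.ball (0 : Euc d) r) := by
      rw [hs, measure_biUnion_finset ?_ fun _ _ => measurableSet_ball]
      · simp [hvol]
      · intro k _ l _ hkl
        refine Metric.ball_disjoint_ball ?_
        have hkl' : 1 ≤ |(k : ℝ) - l| := by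
          have : (1 : ℤ) ≤ |(k : ℤ) - l| := Int.one_le_abs (by omega)
          exact_mod_cast this
        rw [dist_add_left, dist_eq_norm, ← sub_smul, norm_smul, norm_smul, he, Real.norm_eq_abs,
          Real.norm_eq_abs, abs_of_pos (by linarith : 0 < R)]
        nlinarith
    have hmono : eLpNorm (s.indicator fun _ => a / 4) q volume ≤
        eLpNorm (translateSum N (R • e) f) q volume := by
      refine eLpNorm_mono fun x => ?_
      by_cases hx : x ∈ s
      · obtain ⟨k, hk, hxk⟩ := Set.mem_iUnion₂.1 hx
        rw [Set.indicator_of_mem hx, Real.norm_of_nonneg (by positivity)]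
        exact hpt N k (Finset.mem_range.1 hk) x hxk
      · simp [hx]
    rw [eLpNorm_indicator_const hsm hq hqt, hμs, ENNReal.mul_rpow_of_nonneg _ _ (by positivity),
      Real.enorm_eq_ofReal (by positivity)] at hmono
    refine le_of_eq_of_le ?_ hmono
    ring

/-! ### Derivatives -/

theorem lineDerivOp_compSubConstCLM (v w : Euc d) (f : 𝓢(Euc d, ℂ)) :
    ∂_{w} (SchwartzMap.compSubConstCLM ℂ v f) = SchwartzMap.compSubConstCLM ℂ v (∂_{w} f) := by
  ext x
  simp only [SchwartzMap.lineDerivOp_apply, SchwartzMap.compSubConstCLM_apply, lineDeriv,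
    add_sub_right_comm]

theorem lineDerivOp_translateSum (N : ℕ) (v w : Euc d) (f : 𝓢(Euc d, ℂ)) :
    ∂_{w} (translateSum N v f) = translateSum N v (∂_{w} f) := by
  simp only [translateSum, sum_apply, LineDeriv.lineDerivOp_sum,
    lineDerivOp_compSubConstCLM]

theorem multiDeriv_translateSum (α : Fin d → ℕ) (N : ℕ) (v : Euc d) (f : 𝓢(Euc d, ℂ)) :
    multiDeriv α (translateSum N v f) = translateSum N v (multiDeriv α f) := by
  unfold multiDeriv
  induction List.finRange d with
  | nil => rfl
  | cons i l ih =>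
    rw [List.foldr_cons, List.foldr_cons, ih]
    exact (Function.Semiconj.iterate_right
      (f := translateSum N v)
      (ga := fun h : 𝓢(Euc d, ℂ) => ∂_{(EuclideanSpace.single i (1 : ℝ) : Euc d)} h)
      (gb := fun h : 𝓢(Euc d, ℂ) => ∂_{(EuclideanSpace.single i (1 : ℝ) : Euc d)} h)
      (fun g => (lineDerivOp_translateSum N v _ g).symm) (α i) _).symm

/-- If the derivative vanished, `f` would be constant along every line in direction `w`, and decay
at infinity would force the constant to be `0`. -/
theorem lineDerivOp_ne_zero {w : Euc d} (hw : w ≠ 0) {f : 𝓢(Euc d, ℂ)} (hf : f ≠ 0) :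
    ∂_{w} f ≠ 0 := by
  contrapose! hf
  ext x
  have hline (t : ℝ) : HasDerivAt (fun t : ℝ => f (x + t • w)) 0 t := by
    have h := (f.differentiableAt (x := x + t • w)).hasFDerivAt.comp_hasDerivAt t
      (((hasDerivAt_id t).smul_const w).const_add x)
    have h0 : fderiv ℝ f (x + t • w) w = 0 := by
      rw [← SchwartzMap.lineDerivOp_apply_eq_fderiv, hf, zero_apply]
    simpa [h0, Function.comp_def] using h
  have hconst (t : ℝ) : f (x + t • w) = f x := by
    simpa using is_const_of_deriv_eq_zero (fun t => (hline t).differentiableAt)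
      (fun t => (hline t).deriv) t 0
  have hcoc : Tendsto (fun t : ℝ => x + t • w) (cocompact ℝ) (cocompact (Euc d)) := by
    refine (Homeomorph.addLeft x).isClosedEmbedding.tendsto_cocompact.comp ?_
    exact (isClosedEmbedding_smul_left hw).tendsto_cocompact
  have hlim : Tendsto (fun t : ℝ => f (x + t • w)) (cocompact ℝ) (𝓝 0) :=
    (zero_at_infty f).comp hcoc
  simp only [hconst] at hlim
  exact tendsto_nhds_unique tendsto_const_nhds hlim

theorem multiDeriv_ne_zero (α : Fin d → ℕ) {f : 𝓢(Euc d, ℂ)} (hf : f ≠ 0) :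
    multiDeriv α f ≠ 0 := by
  unfold multiDeriv
  induction List.finRange d with
  | nil => exact hf
  | cons i l ih =>
    rw [List.foldr_cons]
    induction α i with
    | zero => exact ih
    | succ n ihn =>
      rw [Function.iterate_succ_apply']
      exact lineDerivOp_ne_zero (by simp) ihn

/-! ### Localized pieces of Schwartz functions -/

theorem fourier_compSubConstCLM (v : Euc d) (f : 𝓢(Euc d, ℂ)) (ξ : Euc d) :
    𝓕 (SchwartzMap.compSubConstCLM ℂ v f) ξ =
      Complex.exp (((-2 * Real.pi * inner ℝ v ξ : ℝ) : ℂ) * Complex.I) * 𝓕 f ξ := by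
  rw [SchwartzMap.fourier_coe, SchwartzMap.fourier_coe, Real.fourier_eq', Real.fourier_eq',
    ← integral_const_mul, ← integral_add_right_eq_self _ v]
  congr 1 with x
  rw [SchwartzMap.compSubConstCLM_apply, add_sub_cancel_right, smul_eq_mul, smul_eq_mul,
    ← mul_assoc, ← Complex.exp_add, inner_add_left]
  congr 2
  push_cast
  ring

/-- The operator `f ↦ 𝓕⁻¹(φ 𝓕 f)` on Schwartz functions. -/
def fourierLocalize (φ : 𝓓(O, ℂ)) : 𝓢(Euc d, ℂ) →L[ℂ] 𝓢(Euc d, ℂ) :=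
  FourierTransform.fourierInvCLM ℂ 𝓢(Euc d, ℂ) ∘L SchwartzMap.smulLeftCLM ℂ (φ : Euc d → ℂ) ∘L
    FourierTransform.fourierCLM ℂ 𝓢(Euc d, ℂ)

theorem hasTemperateGrowth_testFunction (φ : 𝓓(O, ℂ)) :
    Function.HasTemperateGrowth (φ : Euc d → ℂ) :=
  φ.hasCompactSupport.hasTemperateGrowth φ.contDiff

theorem fourierLocalize_apply (φ : 𝓓(O, ℂ)) (f : 𝓢(Euc d, ℂ)) (x : Euc d) :
    fourierLocalize φ f x =
      ∫ ξ, Complex.exp (((2 * Real.pi * inner ℝ ξ x : ℝ) : ℂ) * Complex.I) * (φ ξ * 𝓕 f ξ) := by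
  change 𝓕⁻ (SchwartzMap.smulLeftCLM ℂ (φ : Euc d → ℂ) (𝓕 f)) x = _
  rw [SchwartzMap.fourierInv_coe, Real.fourierInv_eq']
  simp only [SchwartzMap.smulLeftCLM_apply_apply (hasTemperateGrowth_testFunction φ), smul_eq_mul]

theorem fourierLocalize_eq_zero {φ : 𝓓(O, ℂ)} {f : 𝓢(Euc d, ℂ)} (h : ∀ ξ, φ ξ * 𝓕 f ξ = 0) :
    fourierLocalize φ f = 0 := by
  ext x
  simp [fourierLocalize_apply, h]

/-- On the Fourier side, this is a character commuting with multiplication by `φ`. -/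
theorem fourierLocalize_compSubConstCLM (φ : 𝓓(O, ℂ)) (v : Euc d) (f : 𝓢(Euc d, ℂ)) :
    fourierLocalize φ (SchwartzMap.compSubConstCLM ℂ v f) =
      SchwartzMap.compSubConstCLM ℂ v (fourierLocalize φ f) := by
  ext x
  rw [SchwartzMap.compSubConstCLM_apply, fourierLocalize_apply, fourierLocalize_apply]
  congr 1 with ξ
  rw [fourier_compSubConstCLM, mul_left_comm (φ ξ), ← mul_assoc, ← Complex.exp_add, inner_sub_right,
    real_inner_comm ξ v]
  congr 2
  push_cast
  ring

theorem fourierLocalize_translateSum (φ : 𝓓(O, ℂ)) (N : ℕ) (v : Euc d) (f : 𝓢(Euc d, ℂ)) :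
    fourierLocalize φ (translateSum N v f) = translateSum N v (fourierLocalize φ f) := by
  simp only [translateSum, sum_apply, map_sum, fourierLocalize_compSubConstCLM]

/-- The identity `∫ f 𝓕h = ∫ 𝓕f h` moves the transform onto `f`; distributional pieces thus become
Schwartz functions to which the translate estimates apply. -/
theorem localPiece_schwartzToZDual (φ : 𝓓(O, ℂ)) (f : 𝓢(Euc d, ℂ)) :
    localPiece φ (schwartzToZDual O f).fourier = fourierLocalize φ f := by
  ext x
  change ∫ y, f y * 𝓕 (testToSchwartz (modulate φ x)) y = _
  rw [← SchwartzMap.integral_fourier_mul_eq, fourierLocalize_apply]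
  congr 1 with ξ
  change 𝓕 f ξ * (φ ξ * Complex.exp ((2 * Real.pi * inner ℝ x ξ : ℝ) * Complex.I)) = _
  rw [real_inner_comm ξ x]
  ring

theorem fourier_translateSum_eq_zero {f : 𝓢(Euc d, ℂ)} {ξ : Euc d} (h : 𝓕 f ξ = 0) (N : ℕ)
    (v : Euc d) : 𝓕 (translateSum N v f) ξ = 0 := by
  have : 𝓕 (translateSum N v f) =
      ∑ k ∈ Finset.range N, 𝓕 (SchwartzMap.compSubConstCLM ℂ ((k : ℝ) • v) f) := by
    rw [translateSum, sum_apply]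
    exact map_sum (FourierTransform.fourierCLM ℂ 𝓢(Euc d, ℂ)) _ _
  rw [this, sum_apply]
  exact Finset.sum_eq_zero fun k _ => by rw [fourier_compSubConstCLM, h, mul_zero]

theorem translateSum_mem_schwartzOn {f : 𝓢(Euc d, ℂ)} (hf : f ∈ schwartzOn O) (N : ℕ)
    (v : Euc d) : translateSum N v f ∈ schwartzOn O := by
  have h : tsupport (𝓕 (translateSum N v f) : 𝓢(Euc d, ℂ)) ⊆ tsupport (𝓕 f : 𝓢(Euc d, ℂ)) :=
    closure_mono fun ξ hξ h0 => hξ (fourier_translateSum_eq_zero h0 N v)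
  exact ⟨hf.1.of_isClosed_subset (isClosed_tsupport _) h, h.trans hf.2⟩

/-! ### Finitely supported sequences in regular sequence spaces -/

theorem AffineFamily.IsAdmissible.finite_neighbors {Q : AffineFamily d I} {O : Set (Euc d)}
    (hQ : Q.IsAdmissible O) (i : I) : (Q.neighbors i).Finite := by
  obtain ⟨N, hN⟩ := hQ.card_neighbors_le
  exact Set.finite_of_encard_le_coe (hN i)

theorem AffineFamily.mem_neighbors_comm {Q : AffineFamily d I} {i j : I} :
    i ∈ Q.neighbors j ↔ j ∈ Q.neighbors i := by
  simp only [AffineFamily.neighbors, Set.mem_ofPred_eq, Set.inter_comm]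

namespace SequenceSpace.IsRegular

variable {Q : AffineFamily d I} {Y : SequenceSpace I}

open scoped Classical in
theorem single_mem_of_ne_zero (hY : Y.IsRegular Q) {y : I → ℂ} (hy : y ∈ Y.carrier) {i : I}
    (hi : y i ≠ 0) : Pi.single i (1 : ℂ) ∈ Y.carrier := by
  refine (hY.solid _ ⟨(y i)⁻¹ • y, Y.carrier.smul_mem _ hy⟩ fun j => ?_).1
  rcases eq_or_ne j i with rfl | hj
  · simp [hi]
  · rw [Pi.single_eq_of_ne hj, norm_zero]
    exact norm_nonneg _

open scoped Classical in
theorem exists_single_mem (hY : Y.IsRegular Q) (hY0 : Y.carrier ≠ ⊥) :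
    ∃ i, Pi.single i (1 : ℂ) ∈ Y.carrier := by
  obtain ⟨y, hy, hy0⟩ := Y.carrier.exists_mem_ne_zero_of_ne_bot hY0
  obtain ⟨i, hi⟩ := Function.ne_iff.1 hy0
  exact ⟨i, hY.single_mem_of_ne_zero hy hi⟩

open scoped Classical in
-- The clustered unit vector at `i` takes the value `1` at `j`; solidity then extracts the unit
-- vector at `j`.
theorem single_mem_of_mem_neighbors (hY : Y.IsRegular Q) {i j : I}
    (hi : Pi.single i (1 : ℂ) ∈ Y.carrier) (hj : j ∈ Q.neighbors i) :
    Pi.single j (1 : ℂ) ∈ Y.carrier := by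
  obtain ⟨C, hC⟩ := hY.clustering_le
  obtain ⟨hx, -⟩ := hC ⟨_, hi⟩
  refine hY.single_mem_of_ne_zero (i := j) hx ?_
  have : clustering Q (Pi.single i (1 : ℂ)) j = 1 := by
    rw [clustering, finsum_mem_eq_sum_of_subset (t := {i}) _ _ _]
    · simp
    · intro l hl
      by_contra h
      exact hl.2 (by simpa using Pi.single_eq_of_ne (by simpa using h) _)
    · simpa using AffineFamily.mem_neighbors_comm.1 hj
  simp [this]

/-- Sequences supported in a fixed finite set of indices of `Y` are controlled by their supremum. -/
theorem exists_extNorm_le (hY : Y.IsRegular Q) {y : I → ℂ} (hy : y ∈ Y.carrier) :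
    ∃ C : ℝ≥0, ∀ (c : I → ℝ≥0∞) (A : ℝ≥0), (∀ i, c i ≤ A * ‖y i‖ₑ) → Y.extNorm c ≤ C * A := by
  refine ⟨(Y.qnorm ⟨y, hy⟩).toNNReal, fun c A hc => ?_⟩
  have hfin (i : I) : c i ≠ ∞ :=
    ((hc i).trans_lt (ENNReal.mul_lt_top ENNReal.coe_lt_top enorm_lt_top)).ne
  obtain ⟨hx, hle⟩ := hY.solid (fun i => ((c i).toReal : ℂ)) ((A : ℂ) • ⟨y, hy⟩) fun i => by
    have h := ENNReal.toReal_mono (ENNReal.mul_ne_top ENNReal.coe_ne_top enorm_ne_top) (hc i)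
    simpa using h
  rw [extNorm, dif_pos ⟨hfin, hx⟩]
  refine (ENNReal.ofReal_le_ofReal hle).trans_eq ?_
  rw [hY.smul, ENNReal.ofReal_mul (norm_nonneg _), mul_comm, ENNReal.ofReal]
  simp

end SequenceSpace.IsRegular

/-- If `c N^s ≤ C N^t` for all `N`, with `c ≠ 0` and `C < ∞`, then `s ≤ t`. -/
theorem le_of_forall_nat_rpow_le {s t : ℝ} {c : ℝ≥0∞} (hc : c ≠ 0) {C : ℝ≥0}
    (h : ∀ N : ℕ, c * (N : ℝ≥0∞) ^ s ≤ C * (N : ℝ≥0∞) ^ t) : s ≤ t := by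
  by_contra! hst
  have hle (N : ℕ) (hN : N ≠ 0) : c * (N : ℝ≥0∞) ^ (s - t) ≤ C := by
    have hN0 : (N : ℝ≥0∞) ≠ 0 := by exact_mod_cast hN
    have hNt : (N : ℝ≥0∞) ≠ ∞ := ENNReal.natCast_ne_top N
    rw [ENNReal.rpow_sub _ _ hN0 hNt, ← mul_div_assoc]
    exact ENNReal.div_le_of_le_mul (h N)
  -- If `t < s`, the left side tends to `c * ∞ = ∞`, contradicting the finite bound `C`.
  have hlim : Tendsto (fun N : ℕ => c * (N : ℝ≥0∞) ^ (s - t)) atTop (𝓝 (c * ∞)) := by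
    refine ENNReal.Tendsto.const_mul ?_ (.inl ENNReal.top_ne_zero)
    have := (ENNReal.continuous_rpow_const (y := s - t)).tendsto ∞ |>.comp
      ENNReal.tendsto_nat_nhds_top
    rwa [ENNReal.top_rpow_of_pos (sub_pos.2 hst)] at this
  have := le_of_tendsto hlim ((eventually_ne_atTop 0).mono hle)
  rw [ENNReal.mul_top hc] at this
  exact absurd this (by simp)

/-! ### The test family -/

/-- The function `Φ i` itself may vanish identically, but at a point of `Q_i` some `Φ j` is nonzero,
and that point lies in both cells. -/
theorem IsPartitionOfUnity.exists_ne_zero_mem_neighbors {Q : AffineFamily d I} {Φ : I → 𝓓(O, ℂ)}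
    (hΦ : IsPartitionOfUnity Q Φ) (hQ : Q.IsAdmissible (O : Set (Euc d))) (i : I) :
    ∃ j ∈ Q.neighbors i, ∃ ξ, Φ j ξ ≠ 0 := by
  obtain ⟨ξ, hξ⟩ := hQ.nonempty i
  have hξO : ξ ∈ O := by
    have h : ξ ∈ (O : Set (Euc d)) := hQ.covers ▸ Set.mem_iUnion_of_mem i hξ
    exact h
  obtain ⟨j, hj⟩ : ∃ j, Φ j ξ ≠ 0 := by
    by_contra! h
    have h1 := hΦ.hasSum_one ξ hξO
    simp only [h] at h1
    exact zero_ne_one (hasSum_zero.unique h1)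
  exact ⟨j, ⟨ξ, hξ, by_contra fun h => hj (hΦ.eq_zero j ξ h)⟩, ξ, hj⟩

theorem IsPartitionOfUnity.mul_eq_zero {Q : AffineFamily d I} {Φ : I → 𝓓(O, ℂ)}
    (hΦ : IsPartitionOfUnity Q Φ) {j l : I} (hl : l ∉ Q.neighbors j) (ξ : Euc d) :
    Φ l ξ * Φ j ξ = 0 := by
  by_contra h
  exact hl ⟨ξ, by_contra fun h' => h (by rw [hΦ.eq_zero j ξ h', mul_zero]),
    by_contra fun h' => h (by rw [hΦ.eq_zero l ξ h', zero_mul])⟩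

theorem mem_schwartzOn_of_fourier_eq {φ : 𝓓(O, ℂ)} {g : 𝓢(Euc d, ℂ)} (hg : 𝓕 g = testToSchwartz φ) :
    g ∈ schwartzOn O := by
  rw [schwartzOn, Set.mem_ofPred_eq, hg]
  exact ⟨φ.hasCompactSupport, φ.tsupport_subset⟩

/-- If `𝓕 g = φ_j` and the unit vectors at the neighbours of `j` belong to `Y`, the decomposition
space quasi-norm of a sum of `N` translates of `g` is `O(N^{1/p})`. -/
theorem exists_decompNorm_translateSum_le {p : ℝ≥0∞} (hp : p ≠ 0) {Q : AffineFamily d I}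
    (hQ : Q.IsAdmissible (O : Set (Euc d))) {Φ : I → 𝓓(O, ℂ)} (hΦ : IsPartitionOfUnity Q Φ)
    {Y : SequenceSpace I} (hY : Y.IsRegular Q) {j : I}
    (hj : open scoped Classical in Pi.single j (1 : ℂ) ∈ Y.carrier) {g : 𝓢(Euc d, ℂ)}
    (hg : 𝓕 g = testToSchwartz (Φ j)) {e : Euc d} (he : ‖e‖ = 1) {R : ℝ} (hR : 1 ≤ R) :
    ∃ C : ℝ≥0, ∀ N : ℕ, decompNorm p Y Φ (schwartzToZDual O (translateSum N (R • e) g)) ≤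
      C * (N : ℝ≥0∞) ^ (1 / p.toReal) := by
  classical
  set J : Finset I := (hQ.finite_neighbors j).toFinset with hJ
  have hJmem (l : I) : l ∈ J ↔ l ∈ Q.neighbors j := by simp [hJ]
  -- The indicator sequence of `j^*` serves as the dominating element of `Y`.
  have hy : ∑ l ∈ J, Pi.single l (1 : ℂ) ∈ Y.carrier := Y.carrier.sum_mem fun l hl =>
    hY.single_mem_of_mem_neighbors (by convert hj) ((hJmem l).1 hl)
  have hyl (l : I) (hl : l ∈ J) : (∑ l ∈ J, Pi.single l (1 : ℂ) : I → ℂ) l = 1 := by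
    simp [Finset.sum_apply, Pi.single_apply, hl]
  choose C hC using fun l => exists_eLpNorm_translateSum_le hp he hR (fourierLocalize (Φ l) g)
  obtain ⟨C₁, hC₁⟩ := hY.exists_extNorm_le hy
  refine ⟨C₁ * ∑ l ∈ J, C l, fun N => ?_⟩
  have hs : (0 : ℝ) ≤ 1 / p.toReal := by positivity
  have hN : ((N : ℝ≥0) ^ (1 / p.toReal) : ℝ≥0) = (N : ℝ≥0∞) ^ (1 / p.toReal) := by
    rw [ENNReal.coe_rpow_of_nonneg _ hs, ENNReal.coe_natCast]
  refine (hC₁ _ ((∑ l ∈ J, C l) * (N : ℝ≥0) ^ (1 / p.toReal)) fun l => ?_).trans_eq ?_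
  · rw [localPiece_schwartzToZDual, fourierLocalize_translateSum]
    by_cases hl : l ∈ J
    · rw [hyl l hl, enorm_one, mul_one, ENNReal.coe_mul, hN]
      refine (hC l N).trans ?_
      gcongr
      exact Finset.single_le_sum (f := C) (fun _ _ => zero_le) hl
    -- Off `j^*` the supports give `φ_l φ_j = 0`, so these pieces vanish for every `N`.
    · have h0 : fourierLocalize (Φ l) g = 0 := fourierLocalize_eq_zero fun ξ => by
        rw [hg, testToSchwartz_apply]
        exact hΦ.mul_eq_zero (fun h => hl ((hJmem l).2 h)) ξ
      rw [h0, map_zero]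
      exact (eLpNorm_zero (ε := ℂ)).trans_le zero_le
  · rw [ENNReal.coe_mul, ENNReal.coe_mul, hN, mul_assoc]

end DecompositionSpace

end

theorem mainTheorem4 {d : ℕ} (hd : 1 ≤ d) {I : Type*} {p q : ℝ≥0∞} (hp : p ≠ 0) (hq : q ≠ 0)
    (O : Opens (Euc d)) (hO : (O : Set (Euc d)).Nonempty)
    (Q : AffineFamily d I) (hQ : Q.IsSemiStructured (O : Set (Euc d)))
    (Φ : I → 𝓓(O, ℂ)) (hΦ : IsBAPU p Q Φ)
    (Y : SequenceSpace I) (hY : Y.IsRegular Q) (hY0 : Y.carrier ≠ ⊥)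
    (α : Fin d → ℕ) (hα : IsBoundedDeriv p q Y Φ α) :
    p ≤ q := by
  classical
  rcases eq_or_ne q ∞ with rfl | hqt
  · exact le_top
  obtain ⟨i, hi⟩ := hY.exists_single_mem hY0
  obtain ⟨j, hji, ξ, hξ⟩ := hΦ.exists_ne_zero_mem_neighbors hQ.toIsAdmissible i
  have hj := hY.single_mem_of_mem_neighbors hi hji
  set g : 𝓢(Euc d, ℂ) := 𝓕⁻ (testToSchwartz (Φ j))
  have hg : 𝓕 g = testToSchwartz (Φ j) := FourierTransform.fourier_fourierInv_eq _
  have hg0 : g ≠ 0 := by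
    intro h
    have h1 : 𝓕 g = 0 := by
      rw [h]
      exact map_zero (FourierTransform.fourierCLM ℂ 𝓢(Euc d, ℂ))
    rw [hg] at h1
    exact hξ (DFunLike.congr_fun h1 ξ)
  have he : ‖(EuclideanSpace.single ⟨0, hd⟩ 1 : Euc d)‖ = 1 := by simp
  obtain ⟨R, hR, c, hc, hlow⟩ :=
    exists_le_eLpNorm_translateSum hq hqt he (multiDeriv_ne_zero α hg0)
  obtain ⟨C, hC⟩ := exists_decompNorm_translateSum_le hp hQ.toIsAdmissible
    hΦ.toIsPartitionOfUnity hY hj hg he hR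
  obtain ⟨C', hC'⟩ := hα
  have hle : 1 / q.toReal ≤ 1 / p.toReal := by
    refine le_of_forall_nat_rpow_le hc (C := C' * C) fun N => ?_
    have hmem : translateSum N (R • EuclideanSpace.single ⟨0, hd⟩ 1) g ∈ schwartzDecomp p Y Φ :=
      ⟨translateSum_mem_schwartzOn (mem_schwartzOn_of_fourier_eq hg) N _, (hC N).trans_lt <|
        ENNReal.mul_lt_top ENNReal.coe_lt_top <|
          ENNReal.rpow_lt_top_of_nonneg (by positivity) (ENNReal.natCast_ne_top N)⟩
    have h := hC' _ hmem
    rw [multiDeriv_translateSum] at h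
    refine (hlow N).trans (h.trans ?_)
    rw [ENNReal.coe_mul, mul_assoc]
    gcongr
    exact hC N
  have hq0 : 0 < q.toReal := ENNReal.toReal_pos hq hqt
  -- For `p = ∞` the exponent `1 / p.toReal` is `0`, so `hle` would contradict `1 / q.toReal > 0`.
  rcases eq_or_ne p ∞ with rfl | hpt
  · rw [ENNReal.toReal_top, div_zero] at hle
    exact absurd hle (not_le.2 (by positivity))
  · rwa [one_div_le_one_div hq0 (ENNReal.toReal_pos hp hpt), ENNReal.toReal_le_toReal hpt hqt] at hle
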